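/- Let $d_A,d_B\ge 1$ and consider unitaries on $\mathbb{C}^{d_A}\otimes\mathbb{C}^{d_B}$ with computational bases $|j\rangle$ of the two factors. A unitary is controlled in the computational basis from the $A$ side if it has the form $\sum_{j=1}^{d_A}|j\rangle\langle j|\otimes U_j$ with unitaries $U_j$ on $\mathbb{C}^{d_B}$, and from the $B$ side if it has the form $\sum_{j=1}^{d_B}V_j\otimes|j\rangle\langle j|$ with unitaries $V_j$ on $\mathbb{C}^{d_A}$. A controlled unitary is a unitary of the form $(P\otimes Q)\,C\,(R\otimes S)$, where $P,Q,R,S$ are local unitaries and $C$ is controlled in the computational basis from the $A$ side or from the $B$ side. An $m$-sandwich form of $U$ is a decomposition $U=U_1U_2\cdots U_m$ in which $U_i$ is controlled in the computational basis from the $A$ side for odd $i$ and from the $B$ side for even $i$. Let $c(U)$ be the least $k\ge1$ such that $U$ is a product of $k$ controlled unitaries. (i) Every unitary $U$ on $\mathbb{C}^{d_A}\otimes\mathbb{C}^{d_B}$ has a $(2^{\lceil \log_2 d_A\rceil+1}-1)$-sandwich form. Hence, if $d_A\ge 2$, $$c(U)\le 2^{\lceil \log_2 d_A\rceil+1}-1\le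 4d_A-5,$$ and $c(U)\le 2d_A-1$ whenever $d_A$ is a power of $2$. (ii) Fix $d_B$. If for every odd $d_A\ge3$ every unitary on $\mathbb{C}^{d_A}\otimes\mathbb{C}^{d_B}$ has a $(2d_A-1)$-sandwich form, then for every even $d_A\ge2$ every unitary on $\mathbb{C}^{d_A}\otimes\mathbb{C}^{d_B}$ has a $(2d_A-1)$-sandwich form. -/

import Mathlib

open scoped Kronecker

section

variable {a b : Type*} [Fintype a] [DecidableEq a] [Fintype b] [DecidableEq b]

/-- `U = ∑ j, |j⟩⟨j| ⊗ V j` with every `V j` unitary: `U` is controlled from the `A` side in the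
computational basis of `A`. The computational basis of the bipartite space is indexed
by `a × b`. -/
def ControlledInBasisA (U : Matrix (a × b) (a × b) ℂ) : Prop :=
  ∃ V : a → Matrix b b ℂ, (∀ j, V j ∈ Matrix.unitaryGroup b ℂ) ∧
    U = ∑ j : a, Matrix.single j j (1 : ℂ) ⊗ₖ V j

/-- `U = ∑ j, V j ⊗ |j⟩⟨j|` with every `V j` unitary: `U` is controlled from the `B` side in the
computational basis of `B`. -/
def ControlledInBasisB (U : Matrix (a × b) (a × b) ℂ) : Prop :=
  ∃ V : b → Matrix a a ℂ, (∀ j, V j ∈ Matrix.unitaryGroup a ℂ) ∧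
    U = ∑ j : b, V j ⊗ₖ Matrix.single j j (1 : ℂ)

/-- `U` equals `C` up to local unitaries on the left and on the right. -/
def LocallyEquivalent (U C : Matrix (a × b) (a × b) ℂ) : Prop :=
  ∃ P ∈ Matrix.unitaryGroup a ℂ, ∃ Q ∈ Matrix.unitaryGroup b ℂ,
  ∃ R ∈ Matrix.unitaryGroup a ℂ, ∃ S ∈ Matrix.unitaryGroup b ℂ,
    U = (P ⊗ₖ Q) * C * (R ⊗ₖ S)

/-- A controlled unitary gate: locally equivalent to a unitary that is controlled in the
computational basis from the `A` side or from the `B` side. -/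
def IsControlledUnitary (U : Matrix (a × b) (a × b) ℂ) : Prop :=
  ∃ C : Matrix (a × b) (a × b) ℂ,
    (ControlledInBasisA C ∨ ControlledInBasisB C) ∧ LocallyEquivalent U C

/-- `U = U₁ U₂ ⋯ Uₘ` where `Uᵢ` is controlled in the computational basis, from `A` for odd `i`
and from `B` for even `i`. The factor `Uᵢ` is `G (i - 1)`, so the parity is that of `i + 1`
for the index `i : Fin m`. -/
def HasSandwichForm (m : ℕ) (U : Matrix (a × b) (a × b) ℂ) : Prop :=
  ∃ G : Fin m → Matrix (a × b) (a × b) ℂ,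
    (∀ i : Fin m, (Odd ((i : ℕ) + 1) → ControlledInBasisA (G i)) ∧
      (Even ((i : ℕ) + 1) → ControlledInBasisB (G i))) ∧
    U = (List.ofFn G).prod

/-- `U = U₁ U₂ ⋯ Uₖ` for controlled unitaries `Uᵢ`. -/
def IsProductOfControlled (k : ℕ) (U : Matrix (a × b) (a × b) ℂ) : Prop :=
  ∃ G : Fin k → Matrix (a × b) (a × b) ℂ,
    (∀ i, IsControlledUnitary (G i)) ∧ U = (List.ofFn G).prod

/-- The bipartite depth `c(U)`: the least `k ≥ 1` such that `U` is a product of `k` controlled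
unitaries. It takes values in `ℕ∞`, with `c(U) = ⊤` if there is no such `k`. -/
noncomputable def bipartiteDepth (U : Matrix (a × b) (a × b) ℂ) : ℕ∞ :=
  ⨅ k ∈ {k : ℕ | 1 ≤ k ∧ IsProductOfControlled k U}, (k : ℕ∞)

end

/-!
Split the basis of `A` into two parts of nearly equal size. The cosine-sine decomposition writes a
unitary as `(A₀ ⊕ A₁) * M * (B₀ ⊕ B₁)` with blocks acting on the two parts, where `M` rotates each
basis vector of the smaller part against its copy in the larger one. As the two vectors carry the
same label on `B`, the factor `M` is controlled from the `B` side. Sandwich forms of equal length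
combine into sandwich forms of direct sums along `A`, so an odd length `m` that suffices for both
parts yields the length `2 * m + 1` for the whole. Halving down to dimension one, where every
unitary is controlled from the `A` side, gives `2 ^ (⌈log₂ d⌉ + 1) - 1`; halving an even dimension
only down to its odd part gives (ii).

For the cosine-sine decomposition, write `(X Z)` for the upper block row of the unitary. Then
`X * Xᴴ + Z * Zᴴ = 1`, so one unitary diagonalizes both summands, with eigenvalues `cos² θ` and
`sin² θ`. All other factors come from the fact that matrices with equal Gram matrices differ by a
unitary.
-/

section UnitaryGroup

open Matrix

variable {R m n : Type*} [CommRing R] [StarRing R]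
  [Fintype m] [DecidableEq m] [Fintype n] [DecidableEq n]

theorem submatrix_equiv_mem_unitaryGroup {U : Matrix n n R} (hU : U ∈ unitaryGroup n R)
    (e : m ≃ n) : U.submatrix e e ∈ unitaryGroup m R := by
  rw [mem_unitaryGroup_iff] at hU ⊢
  rw [star_eq_conjTranspose, conjTranspose_submatrix, submatrix_mul_equiv,
    ← star_eq_conjTranspose, hU, submatrix_one_equiv]

theorem fromBlocks_diagonal_mem_unitaryGroup {A : Matrix m m R} {B : Matrix n n R}
    (hA : A ∈ unitaryGroup m R) (hB : B ∈ unitaryGroup n R) :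
    fromBlocks A 0 0 B ∈ unitaryGroup (m ⊕ n) R := by
  rw [mem_unitaryGroup_iff, star_eq_conjTranspose] at *
  simp [fromBlocks_conjTranspose, fromBlocks_multiply, hA, hB]

theorem blockDiagonal_mem_unitaryGroup_iff {V : n → Matrix m m R} :
    blockDiagonal V ∈ unitaryGroup (m × n) R ↔ ∀ j, V j ∈ unitaryGroup m R := by
  simp only [mem_unitaryGroup_iff, star_eq_conjTranspose, blockDiagonal_conjTranspose,
    ← blockDiagonal_mul]
  rw [← blockDiagonal_one, blockDiagonal_inj, funext_iff]
  rfl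

end UnitaryGroup

section BlockDiagUnitary

open Matrix

variable {R ι ι' κ κ' : Type*} [CommRing R] [StarRing R]
  [Fintype ι] [DecidableEq ι] [Fintype ι'] [DecidableEq ι']

/-- A unitary that is block diagonal with respect to the partition of the index type into the
fibres of `r`. Being controlled from the `A` or from the `B` side is the case of the projections
`r = Prod.fst` and `r = Prod.snd`, and in this form both sides are treated at once. -/
def IsBlockDiagUnitary (r : ι → κ) (U : Matrix ι ι R) : Prop :=
  U ∈ unitaryGroup ι R ∧ ∀ x y, r x ≠ r y → U x y = 0

namespace IsBlockDiagUnitary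

theorem submatrix {r : ι → κ} {s : ι' → κ} {U : Matrix ι ι R} (hU : IsBlockDiagUnitary r U)
    (e : ι' ≃ ι) (hrs : ∀ x, r (e x) = s x) : IsBlockDiagUnitary s (U.submatrix e e) :=
  ⟨submatrix_equiv_mem_unitaryGroup hU.1 e,
    fun x y hxy => hU.2 (e x) (e y) (by rwa [hrs, hrs])⟩

theorem coarsen {r : ι → κ} {U : Matrix ι ι R} (hU : IsBlockDiagUnitary r U) (g : κ → κ') :
    IsBlockDiagUnitary (g ∘ r) U :=
  ⟨hU.1, fun x y hxy => hU.2 x y (ne_of_apply_ne g hxy)⟩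

theorem fromBlocks {r : ι → κ} {s : ι' → κ} {U : Matrix ι ι R} {V : Matrix ι' ι' R}
    (hU : IsBlockDiagUnitary r U) (hV : IsBlockDiagUnitary s V) :
    IsBlockDiagUnitary (Sum.elim r s) (Matrix.fromBlocks U 0 0 V) := by
  refine ⟨fromBlocks_diagonal_mem_unitaryGroup hU.1 hV.1, ?_⟩
  rintro (x | x) (y | y) hxy
  · exact hU.2 x y hxy
  · rfl
  · rfl
  · exact hV.2 x y hxy

end IsBlockDiagUnitary

end BlockDiagUnitary

section ControlledInBasis

open Matrix

variable {a b : Type*} [Fintype b] [DecidableEq b]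

theorem sum_kronecker_single_eq_blockDiagonal (V : b → Matrix a a ℂ) :
    ∑ j, V j ⊗ₖ single j j (1 : ℂ) = blockDiagonal V := by
  ext ⟨i, k⟩ ⟨j, l⟩
  simp [Matrix.sum_apply, single_apply, blockDiagonal_apply, ite_and]

variable [Fintype a] [DecidableEq a]

theorem controlledInBasisB_iff_isBlockDiagUnitary {U : Matrix (a × b) (a × b) ℂ} :
    ControlledInBasisB U ↔ IsBlockDiagUnitary Prod.snd U := by
  constructor
  · rintro ⟨V, hV, rfl⟩
    rw [sum_kronecker_single_eq_blockDiagonal]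
    exact ⟨blockDiagonal_mem_unitaryGroup_iff.2 hV,
      fun x y hxy => blockDiagonal_apply_ne V x.1 y.1 hxy⟩
  · rintro ⟨hU, hzero⟩
    have hblock : U = blockDiagonal (blockDiag U) := by
      ext ⟨i, k⟩ ⟨j, l⟩
      rw [blockDiagonal_apply']
      split_ifs with hkl
      · rw [hkl, blockDiag_apply]
      · exact hzero _ _ hkl
    rw [hblock] at hU
    exact ⟨blockDiag U, blockDiagonal_mem_unitaryGroup_iff.1 hU,
      hblock.trans (sum_kronecker_single_eq_blockDiagonal _).symm⟩

theorem controlledInBasisA_iff_controlledInBasisB_swap {U : Matrix (a × b) (a × b) ℂ} :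
    ControlledInBasisA U ↔
      ControlledInBasisB (U.submatrix (Equiv.prodComm b a) (Equiv.prodComm b a)) := by
  have hswap (V : a → Matrix b b ℂ) : ∑ j, V j ⊗ₖ single j j (1 : ℂ) =
      (∑ j, single j j (1 : ℂ) ⊗ₖ V j).submatrix (Equiv.prodComm b a) (Equiv.prodComm b a) := by
    ext x y
    simp [Matrix.sum_apply, mul_comm]
  simp only [ControlledInBasisA, ControlledInBasisB, hswap]
  exact exists_congr fun V => and_congr_right fun _ =>
    (reindex (Equiv.prodComm a b) (Equiv.prodComm a b)).injective.eq_iff.symm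

theorem controlledInBasisA_iff_isBlockDiagUnitary {U : Matrix (a × b) (a × b) ℂ} :
    ControlledInBasisA U ↔ IsBlockDiagUnitary Prod.fst U := by
  rw [controlledInBasisA_iff_controlledInBasisB_swap, controlledInBasisB_iff_isBlockDiagUnitary]
  exact ⟨fun h => h.submatrix (Equiv.prodComm a b) fun _ => rfl,
    fun h => h.submatrix (Equiv.prodComm b a) fun _ => rfl⟩

end ControlledInBasis

section GramMatrix

open Matrix

theorem exists_linearIsometryEquiv_of_norm_eq {𝕜 V W : Type*} [RCLike 𝕜] [AddCommGroup V]
    [Module 𝕜 V] [NormedAddCommGroup W] [InnerProductSpace 𝕜 W] [FiniteDimensional 𝕜 W]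
    (f g : V →ₗ[𝕜] W) (h : ∀ v, ‖f v‖ = ‖g v‖) : ∃ e : W ≃ₗᵢ[𝕜] W, ∀ v, f v = e (g v) := by
  have hL (v : V) : f.compLeftInverse g ⟨g v, v, rfl⟩ = f v :=
    f.compLeftInverse_apply_of_bdd g ⟨1, fun v => by rw [one_mul, h]⟩ v (g v) rfl
  let L : LinearMap.range g →ₗᵢ[𝕜] W :=
    { toLinearMap := f.compLeftInverse g
      norm_map' := by
        rintro ⟨_, v, rfl⟩
        exact (congrArg norm (hL v)).trans (h v) }
  exact ⟨L.extend.toLinearIsometryEquiv rfl,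
    fun v => (hL v).symm.trans (L.extend_apply ⟨g v, v, rfl⟩).symm⟩

variable {𝕜 m n : Type*} [RCLike 𝕜]

theorem norm_toEuclideanLin_eq_of_conjTranspose_mul_eq [Fintype m] [Fintype n] [DecidableEq n]
    {Y Z : Matrix m n 𝕜} (h : Yᴴ * Y = Zᴴ * Z) (v : EuclideanSpace 𝕜 n) :
    ‖toEuclideanLin Y v‖ = ‖toEuclideanLin Z v‖ := by
  classical
  have hinner (X : Matrix m n 𝕜) : inner 𝕜 (toEuclideanLin X v) (toEuclideanLin X v) =
      inner 𝕜 v (toEuclideanLin (Xᴴ * X) v) := by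
    rw [← LinearMap.adjoint_inner_right, ← toEuclideanLin_conjTranspose_eq_adjoint,
      toLpLin_mul_same, LinearMap.comp_apply]
  rw [norm_eq_sqrt_re_inner (𝕜 := 𝕜), norm_eq_sqrt_re_inner (𝕜 := 𝕜), hinner, hinner, h]

theorem exists_mem_unitaryGroup_eq_mul_of_conjTranspose_mul_eq [Fintype m] [DecidableEq m]
    [Finite n] {Y Z : Matrix m n 𝕜} (h : Yᴴ * Y = Zᴴ * Z) :
    ∃ A ∈ unitaryGroup m 𝕜, Y = A * Z := by
  classical
  cases nonempty_fintype n
  obtain ⟨e, he⟩ := exists_linearIsometryEquiv_of_norm_eq _ _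
    (norm_toEuclideanLin_eq_of_conjTranspose_mul_eq h)
  let b := EuclideanSpace.basisFun m 𝕜
  let A : Matrix m m 𝕜 := LinearMap.toMatrix b.toBasis b.toBasis e.toLinearMap
  have hA : toEuclideanLin A = e.toLinearMap := by
    rw [toEuclideanLin_eq_toLin_orthonormal, toLin_toMatrix]
  refine ⟨A, e.toMatrix_mem_unitaryGroup b b, toEuclideanLin.injective ?_⟩
  ext1 v
  calc
    toEuclideanLin Y v = toEuclideanLin A (toEuclideanLin Z v) := by rw [he, hA]; rfl
    _ = toEuclideanLin (A * Z) v := by rw [toLpLin_mul_same, LinearMap.comp_apply]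

theorem exists_mem_unitaryGroup_eq_mul_of_mul_conjTranspose_eq [Finite m] [Fintype n]
    [DecidableEq n] {Y Z : Matrix m n 𝕜} (h : Y * Yᴴ = Z * Zᴴ) :
    ∃ B ∈ unitaryGroup n 𝕜, Y = Z * B := by
  obtain ⟨A, hA, hY⟩ := exists_mem_unitaryGroup_eq_mul_of_conjTranspose_mul_eq
    (Y := Yᴴ) (Z := Zᴴ) (by simpa only [conjTranspose_conjTranspose] using h)
  refine ⟨Aᴴ, Unitary.star_mem hA, conjTranspose_injective ?_⟩
  rw [hY, conjTranspose_mul, conjTranspose_conjTranspose]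

theorem exists_eq_fromBlocks_mul_of_toRows₁_eq [Fintype m] [DecidableEq m] [Fintype n]
    [DecidableEq n] {U V : Matrix (m ⊕ n) (m ⊕ n) 𝕜} (hU : U ∈ unitaryGroup (m ⊕ n) 𝕜)
    (hV : V ∈ unitaryGroup (m ⊕ n) 𝕜) (h : U.toRows₁ = V.toRows₁) :
    ∃ A ∈ unitaryGroup n 𝕜, U = fromBlocks 1 0 0 A * V := by
  have hrows {X : Matrix (m ⊕ n) (m ⊕ n) 𝕜} (hX : X ∈ unitaryGroup (m ⊕ n) 𝕜) :
      X.toRows₂ᴴ * X.toRows₂ = 1 - X.toRows₁ᴴ * X.toRows₁ := by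
    rw [eq_sub_iff_add_eq', ← fromCols_mul_fromRows,
      ← conjTranspose_fromRows_eq_fromCols_conjTranspose, fromRows_toRows]
    exact mem_unitaryGroup_iff'.1 hX
  obtain ⟨A, hA, hUV⟩ := exists_mem_unitaryGroup_eq_mul_of_conjTranspose_mul_eq
    ((hrows hU).trans (h ▸ (hrows hV).symm))
  refine ⟨A, hA, ?_⟩
  rw [← fromRows_toRows U, ← fromRows_toRows V, fromBlocks_mul_fromRows, h, hUV]
  simp

end GramMatrix

section CosineSine

open Matrix
open scoped ComplexOrder

variable {𝕜 m k : Type*} [RCLike 𝕜] [DecidableEq m]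

/-- The rotations by the angles `θ i` in the planes spanned by the two copies of the `i`-th basis
vector. -/
noncomputable def planeRotations (𝕜 : Type*) [RCLike 𝕜] (θ : m → ℝ) : Matrix (m ⊕ m) (m ⊕ m) 𝕜 :=
  fromBlocks (diagonal fun i => (Real.cos (θ i) : 𝕜)) (diagonal fun i => (Real.sin (θ i) : 𝕜))
    (-diagonal fun i => (Real.sin (θ i) : 𝕜)) (diagonal fun i => (Real.cos (θ i) : 𝕜))

/-- The middle factor of the cosine-sine decomposition: the rotations `planeRotations 𝕜 θ` on the
two copies of `m`, and the identity on `k`. It is indexed so that a square matrix over it splits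
into the blocks `m` and `m ⊕ k`. -/
noncomputable def cosineSine (𝕜 : Type*) [RCLike 𝕜] (k : Type*) [DecidableEq k] (θ : m → ℝ) :
    Matrix (m ⊕ (m ⊕ k)) (m ⊕ (m ⊕ k)) 𝕜 :=
  (fromBlocks (planeRotations 𝕜 θ) 0 0 1).submatrix (Equiv.sumAssoc m m k).symm
    (Equiv.sumAssoc m m k).symm

theorem toRows₁_cosineSine [DecidableEq k] (θ : m → ℝ) :
    (cosineSine 𝕜 k θ).toRows₁ = fromCols (diagonal fun i => (Real.cos (θ i) : 𝕜))
      (fromCols (diagonal fun i => (Real.sin (θ i) : 𝕜)) 0) := by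
  ext i (j | j | j) <;> rfl

variable [Fintype m]

theorem isBlockDiagUnitary_planeRotations (θ : m → ℝ) :
    IsBlockDiagUnitary (Sum.elim id id) (planeRotations 𝕜 θ) := by
  constructor
  · have hcos_sin (i : m) : (Real.cos (θ i) : 𝕜) * Real.cos (θ i) +
        Real.sin (θ i) * Real.sin (θ i) = 1 := by
      exact_mod_cast (by linarith [Real.cos_sq_add_sin_sq (θ i)] :
        Real.cos (θ i) * Real.cos (θ i) + Real.sin (θ i) * Real.sin (θ i) = 1)
    rw [mem_unitaryGroup_iff, star_eq_conjTranspose, planeRotations, fromBlocks_conjTranspose,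
      fromBlocks_multiply, ← fromBlocks_one]
    simp [diagonal_conjTranspose, Pi.star_def, hcos_sin, mul_comm, add_comm]
  · rintro (i | i) (j | j) (hij : i ≠ j) <;> simp [planeRotations, hij]

theorem isBlockDiagUnitary_cosineSine [Fintype k] [DecidableEq k] (θ : m → ℝ) :
    IsBlockDiagUnitary (Sum.elim Sum.inl id) (cosineSine 𝕜 k θ) := by
  have hone : IsBlockDiagUnitary id (1 : Matrix k k 𝕜) := ⟨one_mem _, fun _ _ => one_apply_ne⟩
  exact (((isBlockDiagUnitary_planeRotations θ).coarsen Sum.inl).fromBlocks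
    (hone.coarsen Sum.inr)).submatrix (Equiv.sumAssoc m m k).symm (by rintro (i | i | i) <;> rfl)

theorem exists_unitary_diagonalizing_cos_sin {p q : Type*} [Fintype p] [Fintype q]
    {X : Matrix m p 𝕜} {Z : Matrix m q 𝕜} (h : X * Xᴴ + Z * Zᴴ = 1) :
    ∃ A ∈ unitaryGroup m 𝕜, ∃ θ : m → ℝ,
      Aᴴ * (X * Xᴴ) * A = diagonal (fun i => (Real.cos (θ i) : 𝕜) ^ 2) ∧
      Aᴴ * (Z * Zᴴ) * A = diagonal fun i => (Real.sin (θ i) : 𝕜) ^ 2 := by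
  have hX : (X * Xᴴ).PosSemidef := posSemidef_self_mul_conjTranspose X
  have hZ : (Z * Zᴴ).PosSemidef := posSemidef_self_mul_conjTranspose Z
  let A : Matrix m m 𝕜 := hX.1.eigenvectorUnitary
  let d := hX.1.eigenvalues
  have hA : Aᴴ * A = 1 := mem_unitaryGroup_iff'.1 hX.1.eigenvectorUnitary.2
  have hXd : Aᴴ * (X * Xᴴ) * A = diagonal fun i => (d i : 𝕜) := by
    have hdiag := hX.1.conjStarAlgAut_star_eigenvectorUnitary
    rwa [Unitary.conjStarAlgAut_star_apply] at hdiag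
  have hZd : Aᴴ * (Z * Zᴴ) * A = diagonal fun i => ((1 - d i : ℝ) : 𝕜) := by
    rw [eq_sub_of_add_eq' h, Matrix.mul_sub, Matrix.sub_mul, Matrix.mul_one, hA, hXd,
      ← diagonal_one, diagonal_sub]
    simp
  have hd_nonneg (i : m) : 0 ≤ d i := hX.eigenvalues_nonneg i
  have hd_le_one (i : m) : 0 ≤ 1 - d i := by
    have hi := (hZ.conjTranspose_mul_mul_same A).diag_nonneg (i := i)
    rw [hZd, diagonal_apply_eq] at hi
    exact_mod_cast hi
  have hcos (i : m) : Real.cos (Real.arccos √(d i)) = √(d i) :=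
    Real.cos_arccos (by linarith [Real.sqrt_nonneg (d i)])
      (Real.sqrt_le_one.2 (by linarith [hd_le_one i]))
  refine ⟨A, hX.1.eigenvectorUnitary.2, fun i => Real.arccos √(d i), ?_, ?_⟩
  · simp only [hXd, hcos, ← RCLike.ofReal_pow, Real.sq_sqrt (hd_nonneg _)]
  · simp only [hZd, Real.sin_arccos, ← RCLike.ofReal_pow, Real.sq_sqrt (hd_nonneg _),
      Real.sq_sqrt (hd_le_one _)]

theorem exists_eq_mul_toRows₁_cosineSine_mul [Fintype k] [DecidableEq k]
    {W : Matrix m (m ⊕ (m ⊕ k)) 𝕜} (hW : W * Wᴴ = 1) :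
    ∃ A ∈ unitaryGroup m 𝕜, ∃ B₀ ∈ unitaryGroup m 𝕜, ∃ B₁ ∈ unitaryGroup (m ⊕ k) 𝕜,
    ∃ θ : m → ℝ, W = A * ((cosineSine 𝕜 k θ).toRows₁ * fromBlocks B₀ 0 0 B₁) := by
  have hsum : W.toCols₁ * W.toCols₁ᴴ + W.toCols₂ * W.toCols₂ᴴ = 1 := by
    rw [← fromCols_mul_fromRows, ← conjTranspose_fromCols_eq_fromRows_conjTranspose,
      fromCols_toCols, hW]
  obtain ⟨A, hA, θ, hcos, hsin⟩ := exists_unitary_diagonalizing_cos_sin hsum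
  obtain ⟨B₀, hB₀, h₁⟩ := exists_mem_unitaryGroup_eq_mul_of_mul_conjTranspose_eq
    (Y := Aᴴ * W.toCols₁) (Z := diagonal fun i => (Real.cos (θ i) : 𝕜)) (by
      simpa [conjTranspose_mul, diagonal_conjTranspose, Pi.star_def, Matrix.mul_assoc, sq]
        using hcos)
  obtain ⟨B₁, hB₁, h₂⟩ := exists_mem_unitaryGroup_eq_mul_of_mul_conjTranspose_eq
    (Y := Aᴴ * W.toCols₂)
    (Z := fromCols (diagonal fun i => (Real.sin (θ i) : 𝕜)) (0 : Matrix m k 𝕜)) (by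
      simpa [conjTranspose_mul, diagonal_conjTranspose, Pi.star_def, Matrix.mul_assoc, sq,
        conjTranspose_fromCols_eq_fromRows_conjTranspose, fromCols_mul_fromRows] using hsin)
  refine ⟨A, hA, B₀, hB₀, B₁, hB₁, θ, ?_⟩
  have hAA : A * Aᴴ = 1 := mem_unitaryGroup_iff.1 hA
  calc
    W = A * (Aᴴ * fromCols W.toCols₁ W.toCols₂) := by
      rw [← Matrix.mul_assoc, hAA, Matrix.one_mul, fromCols_toCols]
    _ = A * ((cosineSine 𝕜 k θ).toRows₁ * fromBlocks B₀ 0 0 B₁) := by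
      rw [mul_fromCols, h₁, h₂, toRows₁_cosineSine, fromCols_mul_fromBlocks, Matrix.mul_zero,
        Matrix.mul_zero, add_zero, zero_add]

theorem exists_cosineSine_decomposition [Fintype k] [DecidableEq k]
    {U : Matrix (m ⊕ (m ⊕ k)) (m ⊕ (m ⊕ k)) 𝕜} (hU : U ∈ unitaryGroup (m ⊕ (m ⊕ k)) 𝕜) :
    ∃ A₀ ∈ unitaryGroup m 𝕜, ∃ A₁ ∈ unitaryGroup (m ⊕ k) 𝕜,
    ∃ B₀ ∈ unitaryGroup m 𝕜, ∃ B₁ ∈ unitaryGroup (m ⊕ k) 𝕜, ∃ θ : m → ℝ,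
      U = fromBlocks A₀ 0 0 A₁ * cosineSine 𝕜 k θ * fromBlocks B₀ 0 0 B₁ := by
  have hrows : U.toRows₁ * U.toRows₁ᴴ = 1 := by
    ext i j
    have hij := congr_fun₂ (mem_unitaryGroup_iff.1 hU) (.inl i) (.inl j)
    simpa [Matrix.mul_apply, one_apply] using hij
  obtain ⟨A₀, hA₀, B₀, hB₀, B₁, hB₁, θ, htop⟩ := exists_eq_mul_toRows₁_cosineSine_mul hrows
  let V := cosineSine 𝕜 k θ * fromBlocks B₀ 0 0 B₁
  have hV : fromBlocks A₀ 0 0 1 * V ∈ unitaryGroup (m ⊕ (m ⊕ k)) 𝕜 :=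
    mul_mem (fromBlocks_diagonal_mem_unitaryGroup hA₀ (one_mem _))
      (mul_mem (isBlockDiagUnitary_cosineSine θ).1 (fromBlocks_diagonal_mem_unitaryGroup hB₀ hB₁))
  have htopV : (fromBlocks A₀ 0 0 1 * V).toRows₁ = A₀ * V.toRows₁ := by
    rw [← fromRows_toRows V, fromBlocks_mul_fromRows, toRows₁_fromRows, Matrix.zero_mul, add_zero,
      fromRows_toRows]
  obtain ⟨A₁, hA₁, h⟩ := exists_eq_fromBlocks_mul_of_toRows₁_eq hU hV (htop.trans htopV.symm)
  refine ⟨A₀, hA₀, A₁, hA₁, B₀, hB₀, B₁, hB₁, θ, ?_⟩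
  rw [h, ← Matrix.mul_assoc, fromBlocks_multiply, Matrix.mul_assoc _ (cosineSine 𝕜 k θ)]
  simp [V]

end CosineSine

section SandwichForm

open Matrix

variable {a a' b : Type*} [Fintype a] [DecidableEq a] [Fintype a'] [DecidableEq a']
  [Fintype b] [DecidableEq b]

/-- `U` may stand at position `i` of a sandwich form, where positions are counted from `1`. -/
def IsSandwichFactor (i : ℕ) (U : Matrix (a × b) (a × b) ℂ) : Prop :=
  (Odd i → ControlledInBasisA U) ∧ (Even i → ControlledInBasisB U)

theorem hasSandwichForm_zero {U : Matrix (a × b) (a × b) ℂ} : HasSandwichForm 0 U ↔ U = 1 := by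
  simp [HasSandwichForm]

theorem hasSandwichForm_succ {m : ℕ} {U : Matrix (a × b) (a × b) ℂ} :
    HasSandwichForm (m + 1) U ↔
      ∃ V C, HasSandwichForm m V ∧ IsSandwichFactor (m + 1) C ∧ U = V * C := by
  constructor
  · rintro ⟨G, hG, rfl⟩
    refine ⟨_, G (Fin.last m), ⟨fun i => G i.castSucc, fun i => hG i.castSucc, rfl⟩,
      hG (Fin.last m), ?_⟩
    rw [List.ofFn_succ', List.concat_eq_append, List.prod_append, List.prod_singleton]
  · rintro ⟨_, C, ⟨G, hG, rfl⟩, hC, rfl⟩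
    refine ⟨Fin.snoc G C, fun i => ?_, ?_⟩
    · cases i using Fin.lastCases with
      | last => simpa [IsSandwichFactor] using hC
      | cast i => simpa using hG i
    · rw [List.ofFn_succ', List.concat_eq_append, List.prod_append, List.prod_singleton]
      simp only [Fin.snoc_castSucc, Fin.snoc_last]

theorem HasSandwichForm.mul {m n : ℕ} (hm : Even m) {U V : Matrix (a × b) (a × b) ℂ}
    (hU : HasSandwichForm m U) (hV : HasSandwichForm n V) : HasSandwichForm (m + n) (U * V) := by
  induction n generalizing V with
  | zero => simpa [hasSandwichForm_zero.1 hV] using hU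
  | succ n ih =>
    obtain ⟨V', C, hV', hC, rfl⟩ := hasSandwichForm_succ.1 hV
    have hC' : IsSandwichFactor (m + n + 1) C := by
      have heven : Even (m + n + 1) ↔ Even (n + 1) := by
        rw [add_assoc, Nat.even_add, iff_true_left hm]
      exact ⟨fun h => hC.1 (by grind), fun h => hC.2 (heven.1 h)⟩
    exact hasSandwichForm_succ.2 ⟨U * V', C, ih hV', hC', (Matrix.mul_assoc _ _ _).symm⟩

theorem HasSandwichForm.mul_controlledInBasisB {m : ℕ} (hm : Odd m)
    {U C : Matrix (a × b) (a × b) ℂ} (hU : HasSandwichForm m U) (hC : ControlledInBasisB C) :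
    HasSandwichForm (m + 1) (U * C) :=
  hasSandwichForm_succ.2
    ⟨U, C, hU, ⟨fun h => absurd hm.add_one (Nat.not_even_iff_odd.2 h), fun _ => hC⟩, rfl⟩

theorem hasSandwichForm_one_of_subsingleton [Subsingleton a] {U : Matrix (a × b) (a × b) ℂ}
    (hU : U ∈ unitaryGroup (a × b) ℂ) : HasSandwichForm 1 U := by
  have hA : ControlledInBasisA U := controlledInBasisA_iff_isBlockDiagUnitary.2
    ⟨hU, fun _ _ h => absurd (Subsingleton.elim _ _) h⟩
  exact hasSandwichForm_succ.2
    ⟨1, U, hasSandwichForm_zero.2 rfl, ⟨fun _ => hA, fun h => absurd h (by decide)⟩,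
      (one_mul U).symm⟩

theorem IsSandwichFactor.reindex {i : ℕ} {U : Matrix (a × b) (a × b) ℂ}
    (hU : IsSandwichFactor i U) (e : a' ≃ a) :
    IsSandwichFactor i
      (U.submatrix (e.prodCongr (Equiv.refl b)) (e.prodCongr (Equiv.refl b))) := by
  refine ⟨fun hi => ?_, fun hi => ?_⟩
  · have h := (controlledInBasisA_iff_isBlockDiagUnitary.1 (hU.1 hi)).coarsen e.symm
    exact controlledInBasisA_iff_isBlockDiagUnitary.2
      (h.submatrix _ fun x => e.symm_apply_apply x.1)
  · have h := controlledInBasisB_iff_isBlockDiagUnitary.1 (hU.2 hi)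
    exact controlledInBasisB_iff_isBlockDiagUnitary.2 (h.submatrix _ fun _ => rfl)

theorem HasSandwichForm.reindex {m : ℕ} {U : Matrix (a × b) (a × b) ℂ} (hU : HasSandwichForm m U)
    (e : a' ≃ a) :
    HasSandwichForm m
      (U.submatrix (e.prodCongr (Equiv.refl b)) (e.prodCongr (Equiv.refl b))) := by
  induction m generalizing U with
  | zero => rw [hasSandwichForm_zero.1 hU, submatrix_one_equiv, hasSandwichForm_zero]
  | succ m ih =>
    obtain ⟨V, C, hV, hC, rfl⟩ := hasSandwichForm_succ.1 hU
    exact hasSandwichForm_succ.2 ⟨_, _, ih hV, hC.reindex e, (submatrix_mul_equiv _ _ _ _ _).symm⟩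

end SandwichForm

section DirectSum

open Matrix

variable {a a' k b : Type*}

/-- The direct sum of operators on two bipartite spaces, taken along the `A` factor. -/
def directSumA (X : Matrix (a × b) (a × b) ℂ) (Y : Matrix (a' × b) (a' × b) ℂ) :
    Matrix ((a ⊕ a') × b) ((a ⊕ a') × b) ℂ :=
  (fromBlocks X 0 0 Y).submatrix (Equiv.sumProdDistrib a a' b) (Equiv.sumProdDistrib a a' b)

theorem directSumA_one [DecidableEq a] [DecidableEq a'] [DecidableEq b] :
    directSumA (1 : Matrix (a × b) (a × b) ℂ) (1 : Matrix (a' × b) (a' × b) ℂ) = 1 := by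
  rw [directSumA, fromBlocks_one, submatrix_one_equiv]

variable [Fintype a] [Fintype a'] [Fintype k] [Fintype b]

theorem directSumA_mul (X X' : Matrix (a × b) (a × b) ℂ) (Y Y' : Matrix (a' × b) (a' × b) ℂ) :
    directSumA (X * X') (Y * Y') = directSumA X Y * directSumA X' Y' := by
  simp [directSumA, submatrix_mul_equiv, fromBlocks_multiply]

variable [DecidableEq a] [DecidableEq a'] [DecidableEq k] [DecidableEq b]

theorem ControlledInBasisA.directSumA {X : Matrix (a × b) (a × b) ℂ}
    {Y : Matrix (a' × b) (a' × b) ℂ} (hX : ControlledInBasisA X) (hY : ControlledInBasisA Y) :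
    ControlledInBasisA (directSumA X Y) := by
  rw [controlledInBasisA_iff_isBlockDiagUnitary] at *
  exact ((hX.coarsen Sum.inl).fromBlocks (hY.coarsen Sum.inr)).submatrix
    (Equiv.sumProdDistrib a a' b) (by rintro ⟨x | x, _⟩ <;> rfl)

theorem ControlledInBasisB.directSumA {X : Matrix (a × b) (a × b) ℂ}
    {Y : Matrix (a' × b) (a' × b) ℂ} (hX : ControlledInBasisB X) (hY : ControlledInBasisB Y) :
    ControlledInBasisB (directSumA X Y) := by
  rw [controlledInBasisB_iff_isBlockDiagUnitary] at *
  exact (hX.fromBlocks hY).submatrix (Equiv.sumProdDistrib a a' b)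
    (by rintro ⟨x | x, _⟩ <;> rfl)

theorem HasSandwichForm.directSumA {m : ℕ} {X : Matrix (a × b) (a × b) ℂ}
    {Y : Matrix (a' × b) (a' × b) ℂ} (hX : HasSandwichForm m X) (hY : HasSandwichForm m Y) :
    HasSandwichForm m (directSumA X Y) := by
  induction m generalizing X Y with
  | zero =>
    rw [hasSandwichForm_zero.1 hX, hasSandwichForm_zero.1 hY, directSumA_one,
      hasSandwichForm_zero]
  | succ m ih =>
    obtain ⟨V, C, hV, hC, rfl⟩ := hasSandwichForm_succ.1 hX
    obtain ⟨W, D, hW, hD, rfl⟩ := hasSandwichForm_succ.1 hY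
    exact hasSandwichForm_succ.2 ⟨_, _, ih hV hW,
      ⟨fun hi => (hC.1 hi).directSumA (hD.1 hi), fun hi => (hC.2 hi).directSumA (hD.2 hi)⟩,
      directSumA_mul _ _ _ _⟩

theorem exists_directSumA_mul_controlledInBasisB_mul_directSumA
    {U : Matrix ((a ⊕ (a ⊕ k)) × b) ((a ⊕ (a ⊕ k)) × b) ℂ}
    (hU : U ∈ unitaryGroup ((a ⊕ (a ⊕ k)) × b) ℂ) :
    ∃ A₀ ∈ unitaryGroup (a × b) ℂ, ∃ A₁ ∈ unitaryGroup ((a ⊕ k) × b) ℂ,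
    ∃ B₀ ∈ unitaryGroup (a × b) ℂ, ∃ B₁ ∈ unitaryGroup ((a ⊕ k) × b) ℂ,
    ∃ C, ControlledInBasisB C ∧ U = directSumA A₀ A₁ * C * directSumA B₀ B₁ := by
  let e₂ := Equiv.sumProdDistrib a k b
  let e := (Equiv.sumProdDistrib a (a ⊕ k) b).trans ((Equiv.refl (a × b)).sumCongr e₂)
  obtain ⟨A₀, hA₀, A₁, hA₁, B₀, hB₀, B₁, hB₁, θ, h⟩ :=
    exists_cosineSine_decomposition (submatrix_equiv_mem_unitaryGroup hU e.symm)
  have hC : ControlledInBasisB ((cosineSine ℂ (k × b) θ).submatrix e e) := by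
    rw [controlledInBasisB_iff_isBlockDiagUnitary]
    have hcosineSine := isBlockDiagUnitary_cosineSine (𝕜 := ℂ) (k := k × b) θ
    exact (hcosineSine.coarsen (Sum.elim Prod.snd Prod.snd)).submatrix e
      (by rintro ⟨x | x | x, _⟩ <;> rfl)
  have hdirectSum (X : Matrix (a × b) (a × b) ℂ) (Y) : (fromBlocks X 0 0 Y).submatrix e e =
      directSumA X (Y.submatrix e₂ e₂) := by
    ext ⟨x | x, _⟩ ⟨y | y, _⟩ <;> rfl
  refine ⟨A₀, hA₀, A₁.submatrix e₂ e₂, submatrix_equiv_mem_unitaryGroup hA₁ e₂, B₀, hB₀,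
    B₁.submatrix e₂ e₂, submatrix_equiv_mem_unitaryGroup hB₁ e₂, _, hC, ?_⟩
  rw [← hdirectSum, ← hdirectSum, submatrix_mul_equiv, submatrix_mul_equiv, ← h,
    submatrix_submatrix, e.symm_comp_self, submatrix_id_id]

end DirectSum

section SandwichUniversal

open Matrix

variable {a a' k b : Type*} [Fintype a] [DecidableEq a] [Fintype a'] [DecidableEq a']
  [Fintype k] [DecidableEq k] [Fintype b] [DecidableEq b]

/-- Sandwich forms of length `m` are universal on the bipartite space indexed by `a × b`: every
unitary has one. The paper's bounds are statements on how `m` may depend on the size of `a`. -/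
def IsSandwichUniversal (a b : Type*) [Fintype a] [DecidableEq a] [Fintype b] [DecidableEq b]
    (m : ℕ) : Prop :=
  ∀ U ∈ unitaryGroup (a × b) ℂ, HasSandwichForm m U

theorem IsSandwichUniversal.congr {m : ℕ} (h : IsSandwichUniversal a b m) (e : a ≃ a') :
    IsSandwichUniversal a' b m := fun U hU => by
  have hform := (h _ (submatrix_equiv_mem_unitaryGroup hU (e.prodCongr (Equiv.refl b)))).reindex
    e.symm
  simpa [submatrix_submatrix, Prod.map_comp_map] using hform

theorem IsSandwichUniversal.sum {m : ℕ} (hm : Odd m) (h₀ : IsSandwichUniversal a b m)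
    (h₁ : IsSandwichUniversal (a ⊕ k) b m) :
    IsSandwichUniversal (a ⊕ (a ⊕ k)) b (2 * m + 1) := fun U hU => by
  obtain ⟨A₀, hA₀, A₁, hA₁, B₀, hB₀, B₁, hB₁, C, hC, rfl⟩ :=
    exists_directSumA_mul_controlledInBasisB_mul_directSumA hU
  have hleft := ((h₀ A₀ hA₀).directSumA (h₁ A₁ hA₁)).mul_controlledInBasisB hm hC
  have hform := hleft.mul hm.add_one ((h₀ B₀ hB₀).directSumA (h₁ B₁ hB₁))
  rwa [show m + 1 + m = 2 * m + 1 by ring] at hform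

theorem IsSandwichUniversal.fin_add {m p q : ℕ} (hm : Odd m) (hpq : p ≤ q)
    (hp : IsSandwichUniversal (Fin p) b m) (hq : IsSandwichUniversal (Fin q) b m) :
    IsSandwichUniversal (Fin (p + q)) b (2 * m + 1) := by
  obtain ⟨r, rfl⟩ := Nat.exists_eq_add_of_le hpq
  exact (hp.sum hm (hq.congr finSumFinEquiv.symm)).congr
    (((Equiv.refl _).sumCongr finSumFinEquiv).trans finSumFinEquiv)

theorem isSandwichUniversal_of_le_two_pow {n d : ℕ} (hd : d ≤ 2 ^ n) :
    IsSandwichUniversal (Fin d) b (2 ^ (n + 1) - 1) := by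
  induction n generalizing d with
  | zero =>
    have : Subsingleton (Fin d) := Fin.subsingleton_iff_le_one.2 hd
    exact fun U hU => hasSandwichForm_one_of_subsingleton hU
  | succ n ih =>
    have hodd : Odd (2 ^ (n + 1) - 1) :=
      Nat.Even.sub_odd Nat.one_le_two_pow (even_two.pow_of_ne_zero n.succ_ne_zero) odd_one
    have h := (ih (d := d / 2) (by omega)).fin_add hodd (by omega) (ih (d := d - d / 2) (by omega))
    have hlength : 2 * (2 ^ (n + 1) - 1) + 1 = 2 ^ (n + 2) - 1 := by
      have := Nat.one_le_two_pow (n := n)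
      rw [pow_succ' 2 (n + 1)]
      omega
    rwa [hlength, Nat.add_sub_of_le (Nat.div_le_self d 2)] at h

theorem IsSandwichUniversal.two_pow_mul {d : ℕ} (hd : 0 < d)
    (h : IsSandwichUniversal (Fin d) b (2 * d - 1)) (n : ℕ) :
    IsSandwichUniversal (Fin (2 ^ n * d)) b (2 * (2 ^ n * d) - 1) := by
  induction n with
  | zero => rwa [pow_zero, one_mul]
  | succ n ih =>
    have hpos : 0 < 2 ^ n * d := by positivity
    have hodd : Odd (2 * (2 ^ n * d) - 1) := ⟨2 ^ n * d - 1, by omega⟩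
    have hlength : 2 * (2 * (2 ^ n * d) - 1) + 1 = 2 * (2 * (2 ^ n * d)) - 1 := by omega
    have h := ih.fin_add hodd le_rfl ih
    rwa [hlength, ← two_mul, ← mul_assoc 2 (2 ^ n), ← pow_succ'] at h

end SandwichUniversal

section BipartiteDepth

variable {a b : Type*} [Fintype a] [DecidableEq a] [Fintype b] [DecidableEq b]

theorem LocallyEquivalent.refl (U : Matrix (a × b) (a × b) ℂ) : LocallyEquivalent U U :=
  ⟨1, one_mem _, 1, one_mem _, 1, one_mem _, 1, one_mem _, by simp⟩

theorem HasSandwichForm.bipartiteDepth_le {m : ℕ} (hm : 1 ≤ m) {U : Matrix (a × b) (a × b) ℂ}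
    (h : HasSandwichForm m U) : bipartiteDepth U ≤ m := by
  obtain ⟨G, hG, hU⟩ := h
  refine iInf₂_le m ⟨hm, G, fun i => ⟨G i, ?_, LocallyEquivalent.refl _⟩, hU⟩
  exact (Nat.even_or_odd ((i : ℕ) + 1)).symm.imp (hG i).1 (hG i).2

end BipartiteDepth

theorem two_pow_clog_succ_sub_one_le {d : ℕ} (hd : 2 ≤ d) :
    2 ^ (Nat.clog 2 d + 1) - 1 ≤ 4 * d - 5 := by
  have hlt : 2 ^ (Nat.clog 2 d - 1) < d := Nat.pow_pred_clog_lt_self one_lt_two hd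
  have hclog : Nat.clog 2 d + 1 = Nat.clog 2 d - 1 + 2 := by
    have := Nat.clog_pos one_lt_two hd
    omega
  rw [hclog, pow_add]
  omega

theorem theorem1 (dB : ℕ) (hB : 1 ≤ dB) :
    (∀ dA : ℕ, 1 ≤ dA →
      ∀ U : Matrix (Fin dA × Fin dB) (Fin dA × Fin dB) ℂ,
        U ∈ Matrix.unitaryGroup (Fin dA × Fin dB) ℂ →
        HasSandwichForm (2 ^ (⌈Real.logb 2 (dA : ℝ)⌉₊ + 1) - 1) U ∧
        (2 ≤ dA →
          bipartiteDepth U ≤ ((2 ^ (⌈Real.logb 2 (dA : ℝ)⌉₊ + 1) - 1 : ℕ) : ℕ∞) ∧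
          2 ^ (⌈Real.logb 2 (dA : ℝ)⌉₊ + 1) - 1 ≤ 4 * dA - 5 ∧
          bipartiteDepth U ≤ ((4 * dA - 5 : ℕ) : ℕ∞)) ∧
        ((∃ n : ℕ, dA = 2 ^ n) → bipartiteDepth U ≤ ((2 * dA - 1 : ℕ) : ℕ∞))) ∧
    ((∀ dA : ℕ, Odd dA → 3 ≤ dA →
        ∀ U : Matrix (Fin dA × Fin dB) (Fin dA × Fin dB) ℂ,
          U ∈ Matrix.unitaryGroup (Fin dA × Fin dB) ℂ → HasSandwichForm (2 * dA - 1) U) →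
      ∀ dA : ℕ, Even dA → 2 ≤ dA →
        ∀ U : Matrix (Fin dA × Fin dB) (Fin dA × Fin dB) ℂ,
          U ∈ Matrix.unitaryGroup (Fin dA × Fin dB) ℂ → HasSandwichForm (2 * dA - 1) U) := by
  refine ⟨fun dA _ U hU => ?_, fun hodd dA _ hdA => ?_⟩
  · have hceil : ⌈Real.logb 2 (dA : ℝ)⌉₊ = Nat.clog 2 dA := Real.natCeil_logb_natCast 2 dA
    rw [hceil]
    have hform : HasSandwichForm (2 ^ (Nat.clog 2 dA + 1) - 1) U :=
      isSandwichUniversal_of_le_two_pow (Nat.le_pow_clog one_lt_two dA) U hU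
    have hdepth := hform.bipartiteDepth_le
      (Nat.le_sub_one_of_lt (Nat.one_lt_two_pow (Nat.succ_ne_zero _)))
    refine ⟨hform, fun h2 => ?_, ?_⟩
    · have hle := two_pow_clog_succ_sub_one_le h2
      exact ⟨hdepth, hle, hdepth.trans (Nat.cast_le.2 hle)⟩
    · rintro ⟨n, rfl⟩
      rwa [Nat.clog_pow 2 n one_lt_two, pow_succ'] at hdepth
  · obtain ⟨n, r, hr, rfl⟩ := Nat.exists_eq_two_pow_mul_odd (Nat.ne_zero_of_lt hdA)
    refine IsSandwichUniversal.two_pow_mul hr.pos ?_ n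
    obtain rfl | hr3 : r = 1 ∨ 3 ≤ r := by grind
    · exact isSandwichUniversal_of_le_two_pow (n := 0) le_rfl
    · exact hodd r hr hr3
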